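/- Let $H$ be a complex Hilbert space and $B(H)$ the algebra of bounded linear operators on $H$. Let $|||\cdot|||$ be a unitarily invariant norm, i.e. a norm defined on a two-sided ideal $\mathcal I$ of $B(H)$ (possibly $\mathcal I=B(H)$) with $|||UTV|||=|||T|||$ for all $T\in\mathcal I$ and all unitary $U,V\in B(H)$. Let $A,B\in B(H)$ be positive definite (that is, positive and invertible) and let $X\in\mathcal I$. For real $\nu$ and $\alpha$ put $$H_\nu=\frac{A^\nu XB^{1-\nu}+A^{1-\nu}XB^\nu}{2},\qquad \mathcal F_\alpha=(1-\alpha)A^{\frac12}XB^{\frac12}+\alpha\,\frac{AX+XB}{2}.$$ Let $\frac12\le\beta,\gamma\le1$ and $\alpha\ge\frac12$. (1) If $\frac{9}{32}\le\nu\le\frac{23}{32}$, then $$|||H_\nu|||\le|||(1-\beta)H_{\frac{5}{16}}+\beta H_{\frac14}|||\le|||\mathcal F_\alpha|||.$$ (2) If $\frac{11}{32}\le\nu\le\frac{21}{32}$, then $$|||H_\nu|||\le|||(1-\gamma)H_{\frac38}+\gamma H_{\frac{5}{16}}|||\le|||(1-\beta)H_{\frac38}+\beta H_{\frac14}|||\le|||\mathcal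 F_\alpha|||.$$ -/

import Mathlib

/-- A unitarily invariant norm on operators on the complex Hilbert space `H`: a norm `|||·|||`
on a two-sided ideal of `B(H)` (all of `B(H)` is allowed), with `|||U T V||| = |||T|||` for all
unitary `U`, `V`. Only the values of `toFun` on `ideal` are meaningful. -/
structure UnitarilyInvariantNorm (H : Type*) [NormedAddCommGroup H] [InnerProductSpace ℂ H]
    [CompleteSpace H] where
  /-- The ideal on which the norm is defined. -/
  ideal : TwoSidedIdeal (H →L[ℂ] H)
  /-- The value `|||T|||`, for `T` in the ideal. -/
  toFun : (H →L[ℂ] H) → ℝ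
  add_le' : ∀ S ∈ ideal, ∀ T ∈ ideal, toFun (S + T) ≤ toFun S + toFun T
  smul' : ∀ (c : ℂ), ∀ T ∈ ideal, toFun (c • T) = ‖c‖ * toFun T
  eq_zero' : ∀ T ∈ ideal, toFun T = 0 → T = 0
  unitary_mul_mul' : ∀ U ∈ unitary (H →L[ℂ] H), ∀ V ∈ unitary (H →L[ℂ] H), ∀ T ∈ ideal,
    toFun (U * T * V) = toFun T

/-- The Heinz mean `H_ν(A, X, B) = (A^ν X B^(1-ν) + A^(1-ν) X B^ν) / 2`; the powers are those of
the continuous functional calculus. -/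
noncomputable def heinzMean {H : Type*} [NormedAddCommGroup H] [InnerProductSpace ℂ H]
    [CompleteSpace H] (ν : ℝ) (A X B : H →L[ℂ] H) : H →L[ℂ] H :=
  (1 / 2 : ℂ) • (A ^ ν * X * B ^ (1 - ν) + A ^ (1 - ν) * X * B ^ ν)

/-- The Heron mean `F_α(A, X, B) = (1 - α) A^(1/2) X B^(1/2) + α (A X + X B) / 2`. -/
noncomputable def heronMean {H : Type*} [NormedAddCommGroup H] [InnerProductSpace ℂ H]
    [CompleteSpace H] (α : ℝ) (A X B : H →L[ℂ] H) : H →L[ℂ] H :=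
  ((1 - α : ℝ) : ℂ) • (A ^ (1 / 2 : ℝ) * X * B ^ (1 / 2 : ℝ))
    + (α : ℂ) • ((1 / 2 : ℂ) • (A * X + X * B))

/-!
Put `a = log A`, `b = log B`, `D Y = a Y - Y b` and `Y = A^(1/2) X B^(1/2)`. Then
`e^(zD) Y = e^(za) Y e^(-zb)`, so that `H_ν = cosh ((ν - 1/2) D) Y` and
`F_α = (1 - α) cosh (0 D) Y + α cosh (D/2) Y`. The whole theorem follows from two facts.

* `|||cosh (t D) Y|||` is an increasing function of `|t|` (`toFun_conjCosh_le`). The operators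
  `e^(isD)` act by multiplication with unitaries and are isometries for `|||·|||`. Hence, for a
  norming functional `φ`, the harmonic function `x + iy ↦ Re φ (e^(iyD) 2 cosh (xD) Y)` is bounded
  on the lines `x = ±κ` by `2 |||cosh (κD) Y|||`, and by the Phragmén-Lindelöf principle it is so on
  the strip between them (`norm_add_neg_le_of_bounded_strip`). No completeness of the ideal and no
  comparison of `|||·|||` with the operator norm is needed: operators are combinations of four
  unitaries, which makes `(S, T) ↦ S Y T` continuous into `(𝓘, |||·|||)`
  (`UnitarilyInvariantNorm.norm_sandwich_le`).

* For `0 ≤ p ≤ q` and `β ≥ 1/2`, the mixture `(1 - β) cosh (pD) Y + β cosh (qD) Y` dominates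
  `cosh (θD) Y` for `|θ| ≤ (p + q)/2` (`toFun_conjCosh_le_mixture`). At `β = 1/2` the mixture is the
  product `cosh ((p + q)D/2) cosh ((q - p)D/2) Y`, and the first fact applies twice. In particular
  the norm at the midpoint is at least the one at `β = 0`, so by convexity in `β` it can only grow
  beyond the midpoint (`toFun_midpoint_le`).

Each inequality of the theorem compares mixtures of this kind, the left-hand side being split by the
triangle inequality.
-/

/-! ### A maximum principle on vertical strips -/

open Complex in
/-- **Three lines inequality for symmetrized values.** The function
`x + i y ↦ V (x + i y) + V (-x + i y)` is harmonic, so on a strip symmetric about the imaginary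
axis it is bounded by its supremum on one boundary line. -/
theorem norm_add_neg_le_of_bounded_strip {E : Type*} [NormedAddCommGroup E] [NormedSpace ℂ E]
    {V : ℂ → E} (hV : Differentiable ℂ V) {κ M K : ℝ}
    (hK : ∀ z : ℂ, |z.re| ≤ κ → ‖V z‖ ≤ K)
    (hM : ∀ s : ℝ, ‖V (κ + s * I) + V (-κ + s * I)‖ ≤ M) {θ : ℝ} (hθ : |θ| ≤ κ) :
    ‖V θ + V (-θ)‖ ≤ M := by
  obtain ⟨φ, hφ, hφV⟩ := exists_dual_vector'' ℂ (V θ + V (-θ))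
  have hφle (v : E) : ‖φ v‖ ≤ ‖v‖ := by
    simpa using φ.le_of_opNorm_le hφ v
  -- The real part of the entire function `G` is `Re φ (V (x + i y) + V (-x + i y))`.
  let G : ℂ → ℂ := fun z => φ (V z) + star (φ (V (-star z)))
  have hGre (z : ℂ) : (G z).re = (φ (V z + V (-star z))).re := by
    simp [G]
  have hφd : Differentiable ℂ fun z => φ (V z) := φ.differentiable.comp hV
  have hG : Differentiable ℂ G := by
    refine hφd.add fun z => ?_
    have h : DifferentiableAt ℂ (fun w => φ (V (-w))) (star z) :=
      (hφd.comp differentiable_neg) _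
    simpa [Function.comp_def] using h.conj_conj
  have hexp : Differentiable ℂ fun z => exp (G z) := hG.cexp
  have hbd (z : ℂ) (hz : |z.re| = κ) : ‖exp (G z)‖ ≤ Real.exp M := by
    rw [norm_exp, hGre, Real.exp_le_exp]
    refine (re_le_norm _).trans ((hφle _).trans ?_)
    rcases abs_choice z.re with h | h
    · have h1 : z = κ + z.im * I := by rw [← hz, h]; exact (re_add_im z).symm
      have h2 : -star z = -κ + z.im * I := by
        apply Complex.ext <;> simp [← hz, h]
      have := hM z.im
      rwa [← h2, ← h1] at this
    · have h1 : -star z = κ + z.im * I := by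
        apply Complex.ext <;> simp [← hz, h]
      have h2 : z = -κ + z.im * I := by
        apply Complex.ext <;> simp [← hz, h]
      have := hM z.im
      rwa [← h2, ← h1, add_comm] at this
  have key : ‖exp (G θ)‖ ≤ Real.exp M := by
    refine PhragmenLindelof.vertical_strip (f := fun z => exp (G z)) (a := -κ) (b := κ)
      (z := θ) hexp.diffContOnCl
      ⟨-1, ?_, 0, ?_⟩ (fun z hz => hbd z ?_) (fun z hz => hbd z ?_) ?_ ?_
    · have : 0 ≤ κ := (abs_nonneg _).trans hθ
      have : 0 ≤ Real.pi / (κ - -κ) := div_nonneg Real.pi_pos.le (by linarith)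
      linarith
    · refine Asymptotics.IsBigO.of_bound (Real.exp (K + K)) ?_
      filter_upwards [Filter.mem_inf_of_right (Filter.mem_principal_self _)] with z hz
      have hz' : |z.re| ≤ κ := abs_le.2 ⟨hz.1.le, hz.2.le⟩
      rw [norm_exp, hGre]
      simp only [zero_mul, Real.exp_zero, norm_one, mul_one, Real.exp_le_exp]
      refine (re_le_norm _).trans ((hφle _).trans ((norm_add_le _ _).trans ?_))
      exact add_le_add (hK z hz') (hK _ (by simpa using hz'))
    · rw [hz, abs_neg, abs_of_nonneg ((abs_nonneg _).trans hθ)]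
    · rw [hz, abs_of_nonneg ((abs_nonneg _).trans hθ)]
    · simpa using (abs_le.1 hθ).1
    · simpa using (abs_le.1 hθ).2
  rw [norm_exp, hGre, Real.exp_le_exp] at key
  have hs : -star (θ : ℂ) = -θ := by simp
  rw [hs, hφV] at key
  simpa using key

/-! ### The normed space underlying a unitarily invariant norm -/

section
variable {H : Type*} [NormedAddCommGroup H] [InnerProductSpace ℂ H] [CompleteSpace H]

namespace UnitarilyInvariantNorm

variable (N : UnitarilyInvariantNorm H)

theorem smul_mem (c : ℂ) {T : H →L[ℂ] H} (hT : T ∈ N.ideal) : c • T ∈ N.ideal := by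
  simpa using N.ideal.mul_mem_left (c • (1 : H →L[ℂ] H)) T hT

/-- The ideal of a unitarily invariant norm as a complex subspace of `B(H)`. -/
def submodule : Submodule ℂ (H →L[ℂ] H) where
  carrier := N.ideal
  add_mem' := N.ideal.add_mem
  zero_mem' := N.ideal.zero_mem
  smul_mem' c _ hT := N.smul_mem c hT

/-- The ideal of a unitarily invariant norm, to be normed by `|||·|||`. It is a new type because
`N.submodule` already carries the operator norm. -/
def Carrier : Type _ := N.submodule

instance : AddCommGroup N.Carrier := inferInstanceAs (AddCommGroup N.submodule)
instance : Module ℂ N.Carrier := inferInstanceAs (Module ℂ N.submodule)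

/-- The inclusion of the ideal in `B(H)`. -/
def incl : N.Carrier →ₗ[ℂ] (H →L[ℂ] H) := N.submodule.subtype

theorem incl_injective : Function.Injective N.incl := Subtype.val_injective

theorem incl_mem (T : N.Carrier) : N.incl T ∈ N.ideal := T.2

noncomputable instance : Norm N.Carrier := ⟨fun T => N.toFun (N.incl T)⟩

theorem norm_def (T : N.Carrier) : ‖T‖ = N.toFun (N.incl T) := rfl

theorem toFun_nonneg {T : H →L[ℂ] H} (hT : T ∈ N.ideal) : 0 ≤ N.toFun T := by
  have h := N.add_le' T hT _ (N.smul_mem (-1) hT)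
  have h0 := N.smul' 0 T hT
  rw [N.smul' _ _ hT] at h
  simp at h h0
  linarith

theorem core : NormedSpace.Core ℂ N.Carrier where
  norm_nonneg T := N.toFun_nonneg (N.incl_mem T)
  norm_smul c T := by simpa [norm_def] using N.smul' c _ (N.incl_mem T)
  norm_triangle S T := by simpa [norm_def] using N.add_le' _ (N.incl_mem S) _ (N.incl_mem T)
  norm_eq_zero_iff T := by
    refine ⟨fun h => N.incl_injective ?_, ?_⟩
    · rw [N.eq_zero' _ (N.incl_mem T) h, map_zero]
    · rintro rfl
      simpa [norm_def] using N.smul' 0 0 N.ideal.zero_mem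

noncomputable instance : NormedAddCommGroup N.Carrier := NormedAddCommGroup.ofCore N.core
noncomputable instance : NormedSpace ℂ N.Carrier := NormedSpace.ofCore N.core


/-- The bilinear map `(S, T) ↦ S Y T` into the ideal, for `Y` in the ideal. -/
def sandwich (Y : N.Carrier) : (H →L[ℂ] H) →ₗ[ℂ] (H →L[ℂ] H) →ₗ[ℂ] N.Carrier :=
  LinearMap.mk₂ ℂ
    (fun S T => (⟨S * N.incl Y * T,
      N.ideal.mul_mem_right _ _ (N.ideal.mul_mem_left _ _ (N.incl_mem Y))⟩ : N.submodule))
    (fun S S' T => Subtype.ext <|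
      show (S + S') * N.incl Y * T = S * N.incl Y * T + S' * N.incl Y * T by simp only [add_mul])
    (fun c S T => Subtype.ext <|
      show c • S * N.incl Y * T = c • (S * N.incl Y * T) by simp only [smul_mul_assoc])
    (fun S T T' => Subtype.ext <|
      show S * N.incl Y * (T + T') = S * N.incl Y * T + S * N.incl Y * T' by simp only [mul_add])
    (fun c S T => Subtype.ext <|
      show S * N.incl Y * c • T = c • (S * N.incl Y * T) by simp only [mul_smul_comm])

theorem norm_sandwich_unitary (Y : N.Carrier) (U V : unitary (H →L[ℂ] H)) :
    ‖N.sandwich Y U V‖ = ‖Y‖ :=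
  N.unitary_mul_mul' _ U.2 _ V.2 _ (N.incl_mem Y)

/-- Every bounded operator is a combination of four unitaries with controlled coefficients, so
`S Y T` depends continuously on `S` and `T` for the norm `|||·|||`. -/
theorem norm_sandwich_le (Y : N.Carrier) (S T : H →L[ℂ] H) :
    ‖N.sandwich Y S T‖ ≤ 4 * ‖Y‖ * ‖S‖ * ‖T‖ := by
  obtain ⟨u, c, hS, hc⟩ := CStarAlgebra.exists_sum_four_unitary S
  obtain ⟨v, d, hT, hd⟩ := CStarAlgebra.exists_sum_four_unitary T
  have hexpand : N.sandwich Y S T = ∑ i, ∑ j, (c i * d j) • N.sandwich Y (u i) (v j) := by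
    conv_lhs => rw [hS, hT]
    simp only [map_sum, map_smul, LinearMap.sum_apply, LinearMap.smul_apply, Finset.smul_sum,
      smul_smul]
    rw [Finset.sum_comm]
    simp only [mul_comm]
  have hterm (i j : Fin 4) :
      ‖(c i * d j) • N.sandwich Y (u i) (v j)‖ ≤ ‖S‖ / 2 * (‖T‖ / 2) * ‖Y‖ := by
    rw [norm_smul, norm_sandwich_unitary, norm_mul]
    gcongr
    · exact hc i
    · exact hd j
  calc ‖N.sandwich Y S T‖
      ≤ ∑ i : Fin 4, ∑ j : Fin 4, ‖S‖ / 2 * (‖T‖ / 2) * ‖Y‖ := by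
        rw [hexpand]
        exact norm_sum_le_of_le _ fun i _ => norm_sum_le_of_le _ fun j _ => hterm i j
    _ = 4 * ‖Y‖ * ‖S‖ * ‖T‖ := by simp; ring

/-- `(S, T) ↦ S Y T` as a continuous bilinear map. -/
noncomputable def sandwichL (Y : N.Carrier) :
    (H →L[ℂ] H) →L[ℂ] (H →L[ℂ] H) →L[ℂ] N.Carrier :=
  (N.sandwich Y).mkContinuous₂ (4 * ‖Y‖) (N.norm_sandwich_le Y)

end UnitarilyInvariantNorm

/-! ### The one-parameter group generated by `Y ↦ a Y - Y b` -/

open NormedSpace (exp)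

theorem exp_add_smul (a : H →L[ℂ] H) (z w : ℂ) :
    exp ((z + w) • a) = exp (z • a) * exp (w • a) := by
  let +nondep : NormedAlgebra ℚ (H →L[ℂ] H) := .restrictScalars ℚ ℂ _
  rw [add_smul]
  exact NormedSpace.exp_add_of_commute (((Commute.refl a).smul_left z).smul_right w)

theorem exp_I_smul_mem_unitary {a : H →L[ℂ] H} (ha : IsSelfAdjoint a) (s : ℝ) :
    exp ((s * Complex.I) • a) ∈ unitary (H →L[ℂ] H) := by
  have h := (selfAdjoint.expUnitary (s • (⟨a, ha⟩ : selfAdjoint (H →L[ℂ] H)))).2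
  have h2 : Complex.I • (s • a) = (s * Complex.I) • a := by
    rw [← Complex.coe_smul, smul_smul, mul_comm]
  simpa [h2] using h

theorem differentiable_exp_smul (a : H →L[ℂ] H) : Differentiable ℂ fun z : ℂ => exp (z • a) :=
  fun z => (hasDerivAt_exp_smul_const a z).differentiableAt

/-- `e^{zD} Y = e^{z a} Y e^{-z b}`, where `D Y = a Y - Y b`. -/
noncomputable def conjExp (a b : H →L[ℂ] H) (z : ℂ) : (H →L[ℂ] H) →ₗ[ℂ] (H →L[ℂ] H) :=
  LinearMap.mulLeft ℂ (exp (z • a)) ∘ₗ LinearMap.mulRight ℂ (exp ((-z) • b))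

theorem conjExp_apply (a b : H →L[ℂ] H) (z : ℂ) (Y : H →L[ℂ] H) :
    conjExp a b z Y = exp (z • a) * Y * exp ((-z) • b) := by
  simp [conjExp, mul_assoc]

theorem conjExp_conjExp (a b : H →L[ℂ] H) (z w : ℂ) (Y : H →L[ℂ] H) :
    conjExp a b z (conjExp a b w Y) = conjExp a b (z + w) Y := by
  rw [conjExp_apply, conjExp_apply, conjExp_apply, exp_add_smul, neg_add, add_comm (-z),
    exp_add_smul]
  simp only [mul_assoc]

theorem conjExp_zero (a b Y : H →L[ℂ] H) : conjExp a b 0 Y = Y := by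
  simp [conjExp_apply]

theorem conjExp_mem (N : UnitarilyInvariantNorm H) (a b : H →L[ℂ] H) (z : ℂ) {Y : H →L[ℂ] H}
    (hY : Y ∈ N.ideal) : conjExp a b z Y ∈ N.ideal := by
  rw [conjExp_apply]
  exact N.ideal.mul_mem_right _ _ (N.ideal.mul_mem_left _ _ hY)

theorem toFun_conjExp_I (N : UnitarilyInvariantNorm H) {a b : H →L[ℂ] H} (ha : IsSelfAdjoint a)
    (hb : IsSelfAdjoint b) (s : ℝ) {Y : H →L[ℂ] H} (hY : Y ∈ N.ideal) :
    N.toFun (conjExp a b (s * Complex.I) Y) = N.toFun Y := by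
  rw [conjExp_apply]
  refine N.unitary_mul_mul' _ (exp_I_smul_mem_unitary ha s) _ ?_ _ hY
  simpa using exp_I_smul_mem_unitary hb (-s)

/-- `cosh (t D) Y = (e^{tD} Y + e^{-tD} Y) / 2`, where `D Y = a Y - Y b`. -/
noncomputable def conjCosh (a b : H →L[ℂ] H) (t : ℝ) : (H →L[ℂ] H) →ₗ[ℂ] (H →L[ℂ] H) :=
  (1 / 2 : ℂ) • (conjExp a b t + conjExp a b (-t))

theorem conjCosh_apply (a b : H →L[ℂ] H) (t : ℝ) (Y : H →L[ℂ] H) :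
    conjCosh a b t Y = (1 / 2 : ℂ) • (conjExp a b t Y + conjExp a b (-t) Y) := rfl

theorem conjCosh_zero (a b Y : H →L[ℂ] H) : conjCosh a b 0 Y = Y := by
  rw [conjCosh_apply]
  simp only [Complex.ofReal_zero, neg_zero, conjExp_zero]
  module

theorem conjCosh_mem (N : UnitarilyInvariantNorm H) (a b : H →L[ℂ] H) (t : ℝ) {Y : H →L[ℂ] H}
    (hY : Y ∈ N.ideal) : conjCosh a b t Y ∈ N.ideal :=
  N.smul_mem _ (N.ideal.add_mem (conjExp_mem N a b _ hY) (conjExp_mem N a b _ hY))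

/-- The product formula `cosh s * cosh t = (cosh (s + t) + cosh (s - t)) / 2`. -/
theorem conjCosh_conjCosh (a b : H →L[ℂ] H) (s t : ℝ) (Y : H →L[ℂ] H) :
    conjCosh a b s (conjCosh a b t Y)
      = (1 / 2 : ℂ) • (conjCosh a b (s - t) Y + conjCosh a b (s + t) Y) := by
  simp only [conjCosh_apply, map_smul, map_add, conjExp_conjExp, Complex.ofReal_add,
    Complex.ofReal_sub, neg_add, neg_sub']
  simp only [sub_eq_add_neg, neg_neg]
  module

/-- `|||cosh (tD) Y|||` increases with `|t|`: the entire function `z ↦ e^{zD} Y` is bounded on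
vertical strips, and translations along the imaginary axis are isometries. -/
theorem toFun_conjCosh_le (N : UnitarilyInvariantNorm H) {a b : H →L[ℂ] H}
    (ha : IsSelfAdjoint a) (hb : IsSelfAdjoint b) {θ κ : ℝ} (hθ : |θ| ≤ κ) {Y : H →L[ℂ] H}
    (hY : Y ∈ N.ideal) : N.toFun (conjCosh a b θ Y) ≤ N.toFun (conjCosh a b κ Y) := by
  let Y' : N.Carrier := (⟨Y, hY⟩ : N.submodule)
  let V : ℂ → N.Carrier := fun z => N.sandwichL Y' (exp (z • a)) (exp ((-z) • b))
  have hVincl (z : ℂ) : N.incl (V z) = conjExp a b z Y := (conjExp_apply a b z Y).symm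
  have hV : Differentiable ℂ V := fun z =>
    (((N.sandwichL Y').differentiable _).comp z (differentiable_exp_smul a z)).clm_apply
      (((differentiable_exp_smul b).comp differentiable_neg) z)
  have hnorm (z : ℂ) (s : ℝ) : ‖V (z + s * Complex.I) + V (-z + s * Complex.I)‖
      = N.toFun (conjExp a b z Y + conjExp a b (-z) Y) := by
    rw [N.norm_def, map_add, hVincl, hVincl, add_comm z, add_comm (-z), ← conjExp_conjExp,
      ← conjExp_conjExp, ← map_add]
    exact toFun_conjExp_I N ha hb s
      (N.ideal.add_mem (conjExp_mem N a b _ hY) (conjExp_mem N a b _ hY))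
  have hbound : ∃ K, ∀ z : ℂ, |z.re| ≤ κ → ‖V z‖ ≤ K := by
    have hcont : Continuous fun x : ℝ => ‖V x‖ :=
      (hV.continuous.comp Complex.continuous_ofReal).norm
    obtain ⟨K, hK⟩ := (isCompact_Icc (a := -κ) (b := κ)).bddAbove_image hcont.continuousOn
    refine ⟨K, fun z hz => ?_⟩
    have h : ‖V z‖ = ‖V z.re‖ := by
      conv_lhs => rw [← Complex.re_add_im z, N.norm_def, hVincl, add_comm, ← conjExp_conjExp,
        toFun_conjExp_I N ha hb _ (conjExp_mem N a b _ hY), ← hVincl, ← N.norm_def]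
    rw [h]
    exact hK ⟨z.re, abs_le.1 hz, rfl⟩
  obtain ⟨K, hK⟩ := hbound
  have hmain := norm_add_neg_le_of_bounded_strip hV hK (fun s => (hnorm κ s).le) hθ
  have h0 := hnorm θ 0
  rw [Complex.ofReal_zero, zero_mul, add_zero, add_zero] at h0
  rw [h0] at hmain
  rw [conjCosh_apply, conjCosh_apply,
    N.smul' _ _ (N.ideal.add_mem (conjExp_mem N a b _ hY) (conjExp_mem N a b _ hY)),
    N.smul' _ _ (N.ideal.add_mem (conjExp_mem N a b _ hY) (conjExp_mem N a b _ hY))]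
  gcongr

/-- The case `θ = 0`: `|||Y||| ≤ |||cosh (κD) Y|||`. -/
theorem toFun_le_toFun_conjCosh (N : UnitarilyInvariantNorm H) {a b : H →L[ℂ] H}
    (ha : IsSelfAdjoint a) (hb : IsSelfAdjoint b) {κ : ℝ} (hκ : 0 ≤ κ) {Y : H →L[ℂ] H}
    (hY : Y ∈ N.ideal) : N.toFun Y ≤ N.toFun (conjCosh a b κ Y) := by
  simpa [conjCosh_zero] using toFun_conjCosh_le N ha hb (θ := 0) (by simpa using hκ) hY

/-! ### Segments beyond their midpoint -/

/-- On the line through `P` and `Q` the norm is convex, so if it is no smaller at the midpoint than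
at `P`, it is no smaller at any point beyond the midpoint than at the midpoint. -/
theorem toFun_midpoint_le (N : UnitarilyInvariantNorm H) {P Q : H →L[ℂ] H} (hP : P ∈ N.ideal)
    (hQ : Q ∈ N.ideal) (h : N.toFun P ≤ N.toFun ((1 / 2 : ℂ) • (P + Q))) {β : ℝ}
    (hβ : 1 / 2 ≤ β) :
    N.toFun ((1 / 2 : ℂ) • (P + Q)) ≤ N.toFun (((1 - β : ℝ) : ℂ) • P + (β : ℂ) • Q) := by
  set M := N.toFun ((1 / 2 : ℂ) • (P + Q))
  set R := ((1 - β : ℝ) : ℂ) • P + (β : ℂ) • Q with hR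
  have hβ0 : 0 < β := by linarith
  -- The midpoint divides the segment from `P` to `R` in the ratio `1 / (2 * β)`.
  have hsplit : (1 / 2 : ℂ) • (P + Q)
      = ((1 / (2 * β) : ℝ) : ℂ) • R + ((1 - 1 / (2 * β) : ℝ) : ℂ) • P := by
    have hβc : (β : ℂ) ≠ 0 := by exact_mod_cast hβ0.ne'
    rw [hR]
    push_cast
    match_scalars
    · field_simp
      ring
    · field_simp
  have hRmem : R ∈ N.ideal := N.ideal.add_mem (N.smul_mem _ hP) (N.smul_mem _ hQ)
  have hc : 1 / (2 * β) ≤ 1 := by rw [div_le_one (by positivity)]; linarith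
  have hc0 : 0 < 1 / (2 * β) := by positivity
  have hle : M ≤ 1 / (2 * β) * N.toFun R + (1 - 1 / (2 * β)) * N.toFun P := by
    have := N.add_le' _ (N.smul_mem ((1 / (2 * β) : ℝ) : ℂ) hRmem) _
      (N.smul_mem ((1 - 1 / (2 * β) : ℝ) : ℂ) hP)
    rw [← hsplit, N.smul' _ _ hRmem, N.smul' _ _ hP, Complex.norm_of_nonneg hc0.le,
      Complex.norm_of_nonneg (by linarith)] at this
    exact this
  have h2 : (1 - 1 / (2 * β)) * N.toFun P ≤ (1 - 1 / (2 * β)) * M :=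
    mul_le_mul_of_nonneg_left h (by linarith)
  refine le_of_mul_le_mul_left ?_ hc0
  linarith

theorem toFun_convex_le (N : UnitarilyInvariantNorm H) {P Q : H →L[ℂ] H} (hP : P ∈ N.ideal)
    (hQ : Q ∈ N.ideal) {β : ℝ} (hβ0 : 0 ≤ β) (hβ1 : β ≤ 1) {C : ℝ} (hPC : N.toFun P ≤ C)
    (hQC : N.toFun Q ≤ C) : N.toFun (((1 - β : ℝ) : ℂ) • P + (β : ℂ) • Q) ≤ C := by
  have h := N.add_le' _ (N.smul_mem ((1 - β : ℝ) : ℂ) hP) _ (N.smul_mem (β : ℂ) hQ)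
  rw [N.smul' _ _ hP, N.smul' _ _ hQ, Complex.norm_of_nonneg hβ0,
    Complex.norm_of_nonneg (by linarith)] at h
  have h1 := mul_le_mul_of_nonneg_left hPC (sub_nonneg.2 hβ1)
  have h2 := mul_le_mul_of_nonneg_left hQC hβ0
  linarith

/-- `(cosh p + cosh q) / 2` factors as `cosh ((p + q) / 2) * cosh ((q - p) / 2)`; so the norm of the
mixture `(1 - β) cosh p + β cosh q` with `β ≥ 1 / 2` dominates that of `cosh θ` for every `θ` up to
the mean of `p` and `q`. -/
theorem toFun_conjCosh_le_mixture (N : UnitarilyInvariantNorm H) {a b : H →L[ℂ] H}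
    (ha : IsSelfAdjoint a) (hb : IsSelfAdjoint b) {p q θ β : ℝ} (hp : 0 ≤ p) (hpq : p ≤ q)
    (hθ : |θ| ≤ (p + q) / 2) (hβ : 1 / 2 ≤ β) {Y : H →L[ℂ] H} (hY : Y ∈ N.ideal) :
    N.toFun (conjCosh a b θ Y)
      ≤ N.toFun (((1 - β : ℝ) : ℂ) • conjCosh a b p Y + (β : ℂ) • conjCosh a b q Y) := by
  have hmid {θ : ℝ} (hθ : |θ| ≤ (p + q) / 2) : N.toFun (conjCosh a b θ Y)
      ≤ N.toFun ((1 / 2 : ℂ) • (conjCosh a b p Y + conjCosh a b q Y)) := by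
    have hfactor : (1 / 2 : ℂ) • (conjCosh a b p Y + conjCosh a b q Y)
        = conjCosh a b ((q - p) / 2) (conjCosh a b ((p + q) / 2) Y) := by
      rw [conjCosh_conjCosh, show (q - p) / 2 + (p + q) / 2 = q by ring,
        show (q - p) / 2 - (p + q) / 2 = -p by ring]
      simp only [conjCosh_apply, Complex.ofReal_neg, neg_neg]
      module
    rw [hfactor]
    exact (toFun_conjCosh_le N ha hb hθ hY).trans
      (toFun_le_toFun_conjCosh N ha hb (by linarith) (conjCosh_mem N a b _ hY))
  refine (hmid hθ).trans (toFun_midpoint_le N (conjCosh_mem N a b _ hY) (conjCosh_mem N a b _ hY)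
    (hmid ?_) hβ)
  rw [abs_of_nonneg hp]
  linarith

/-! ### Heinz and Heron means as hyperbolic cosines -/

theorem rpow_eq_exp_smul_log {A : H →L[ℂ] H} (hA : IsStrictlyPositive A) (x : ℝ) :
    A ^ x = exp ((x : ℂ) • CFC.log A) := by
  have hpos : ∀ y ∈ spectrum ℝ A, 0 < y := fun y hy => hA.spectrum_pos hy
  have hlog : ContinuousOn Real.log (spectrum ℝ A) :=
    Real.continuousOn_log.mono fun y hy => (hpos y hy).ne'
  rw [Complex.coe_smul, CFC.log, ← cfc_const_mul x Real.log A hlog,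
    ← CFC.real_exp_eq_normedSpace_exp (cfc_predicate _ _),
    ← cfc_comp' Real.exp (fun y => x * Real.log y) A Real.continuous_exp.continuousOn
      (continuousOn_const.mul hlog), CFC.rpow_eq_cfc_real hA.nonneg]
  refine cfc_congr fun y hy => ?_
  rw [Real.rpow_def_of_pos (hpos y hy), mul_comm]

theorem heinzMean_eq_conjCosh (ν : ℝ) {A B : H →L[ℂ] H} (X : H →L[ℂ] H)
    (hA : IsStrictlyPositive A) (hB : IsStrictlyPositive B) :
    heinzMean ν A X B = conjCosh (CFC.log A) (CFC.log B) (ν - 1 / 2)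
      (A ^ (1 / 2 : ℝ) * X * B ^ (1 / 2 : ℝ)) := by
  have h (x : ℝ) : conjExp (CFC.log A) (CFC.log B) x (A ^ (1 / 2 : ℝ) * X * B ^ (1 / 2 : ℝ))
      = A ^ (x + 1 / 2) * X * B ^ (1 / 2 - x) := by
    simp only [conjExp_apply, rpow_eq_exp_smul_log hA, rpow_eq_exp_smul_log hB, Complex.ofReal_add,
      Complex.ofReal_neg, sub_eq_add_neg, exp_add_smul, mul_assoc]
  rw [conjCosh_apply, ← Complex.ofReal_neg, h, h, heinzMean,
    sub_add_cancel, neg_sub, show (1 / 2 : ℝ) - (ν - 1 / 2) = 1 - ν by ring,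
    show (1 / 2 : ℝ) - ν + 1 / 2 = 1 - ν by ring, sub_sub_cancel]

theorem heronMean_eq_conjCosh (α : ℝ) {A B : H →L[ℂ] H} (X : H →L[ℂ] H)
    (hA : IsStrictlyPositive A) (hB : IsStrictlyPositive B) :
    heronMean α A X B
      = ((1 - α : ℝ) : ℂ) • conjCosh (CFC.log A) (CFC.log B) 0
          (A ^ (1 / 2 : ℝ) * X * B ^ (1 / 2 : ℝ))
        + (α : ℂ) • conjCosh (CFC.log A) (CFC.log B) (1 / 2)
          (A ^ (1 / 2 : ℝ) * X * B ^ (1 / 2 : ℝ)) := by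
  have h := heinzMean_eq_conjCosh 1 X hA hB
  rw [show (1 : ℝ) - 1 / 2 = 1 / 2 by norm_num] at h
  rw [conjCosh_zero, ← h, heronMean, heinzMean, sub_self, CFC.rpow_one A hA.nonneg,
    CFC.rpow_one B hB.nonneg, CFC.rpow_zero A hA.nonneg, CFC.rpow_zero B hB.nonneg, mul_one,
    one_mul]

end

theorem theorem2p3 {H : Type*} [NormedAddCommGroup H] [InnerProductSpace ℂ H] [CompleteSpace H]
    (N : UnitarilyInvariantNorm H) (A X B : H →L[ℂ] H)
    (hA : IsStrictlyPositive A) (hB : IsStrictlyPositive B) (hX : X ∈ N.ideal)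
    (α β γ : ℝ) (hα : 1 / 2 ≤ α) (hβ : 1 / 2 ≤ β) (hβ' : β ≤ 1) (hγ : 1 / 2 ≤ γ) (hγ' : γ ≤ 1) :
    (∀ ν : ℝ, 9 / 32 ≤ ν → ν ≤ 23 / 32 →
      N.toFun (heinzMean ν A X B) ≤
          N.toFun (((1 - β : ℝ) : ℂ) • heinzMean (5 / 16) A X B
            + (β : ℂ) • heinzMean (1 / 4) A X B) ∧
        N.toFun (((1 - β : ℝ) : ℂ) • heinzMean (5 / 16) A X B
            + (β : ℂ) • heinzMean (1 / 4) A X B) ≤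
          N.toFun (heronMean α A X B)) ∧
    (∀ ν : ℝ, 11 / 32 ≤ ν → ν ≤ 21 / 32 →
      N.toFun (heinzMean ν A X B) ≤
          N.toFun (((1 - γ : ℝ) : ℂ) • heinzMean (3 / 8) A X B
            + (γ : ℂ) • heinzMean (5 / 16) A X B) ∧
        N.toFun (((1 - γ : ℝ) : ℂ) • heinzMean (3 / 8) A X B
            + (γ : ℂ) • heinzMean (5 / 16) A X B) ≤
          N.toFun (((1 - β : ℝ) : ℂ) • heinzMean (3 / 8) A X B
            + (β : ℂ) • heinzMean (1 / 4) A X B) ∧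
        N.toFun (((1 - β : ℝ) : ℂ) • heinzMean (3 / 8) A X B
            + (β : ℂ) • heinzMean (1 / 4) A X B) ≤
          N.toFun (heronMean α A X B)) := by
  
  set Y := A ^ (1 / 2 : ℝ) * X * B ^ (1 / 2 : ℝ) with hYdef
  have hY : Y ∈ N.ideal := N.ideal.mul_mem_right _ _ (N.ideal.mul_mem_left _ _ hX)
  have ha : IsSelfAdjoint (CFC.log A) := IsSelfAdjoint.log
  have hb : IsSelfAdjoint (CFC.log B) := IsSelfAdjoint.log
  have hmem (t : ℝ) : conjCosh (CFC.log A) (CFC.log B) t Y ∈ N.ideal := conjCosh_mem N _ _ t hY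
  -- Reflecting `3 / 8`, `5 / 16` and `1 / 4` in `1 / 2` makes the arguments of `cosh` nonnegative.
  have hneg (ν : ℝ) : heinzMean ν A X B = conjCosh (CFC.log A) (CFC.log B) (1 / 2 - ν) Y := by
    rw [heinzMean_eq_conjCosh ν X hA hB, conjCosh_apply, conjCosh_apply, add_comm]
    congr <;> push_cast <;> ring
  simp only [hneg, heronMean_eq_conjCosh α X hA hB, ← hYdef]
  -- `F_α` mixes `cosh 0` and `cosh (D / 2)`, whose mean argument is `1 / 4`.
  have hheron {t : ℝ} (ht : |t| ≤ 1 / 4) := toFun_conjCosh_le_mixture N ha hb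
    (p := 0) (q := 1 / 2) (θ := t) le_rfl (by norm_num) (by linarith) hα hY
  have hβ0 : 0 ≤ β := by linarith
  have hγ0 : 0 ≤ γ := by linarith
  refine ⟨fun ν hν hν' => ⟨?_, ?_⟩, fun ν hν hν' => ⟨?_, ?_, ?_⟩⟩
  · refine toFun_conjCosh_le_mixture N ha hb (by norm_num) (by norm_num) ?_ hβ hY
    rw [abs_le]
    constructor <;> linarith
  · exact toFun_convex_le N (hmem _) (hmem _) hβ0 hβ' (hheron (by norm_num [abs_of_pos]))
      (hheron (by norm_num [abs_of_pos]))
  · refine toFun_conjCosh_le_mixture N ha hb (by norm_num) (by norm_num) ?_ hγ hY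
    rw [abs_le]
    constructor <;> linarith
  · refine toFun_convex_le N (hmem _) (hmem _) hγ0 hγ' ?_ ?_ <;>
    · refine toFun_conjCosh_le_mixture N ha hb (by norm_num) (by norm_num) ?_ hβ hY
      norm_num [abs_of_pos]
  · exact toFun_convex_le N (hmem _) (hmem _) hβ0 hβ' (hheron (by norm_num [abs_of_pos]))
      (hheron (by norm_num [abs_of_pos]))
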